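/- Let $\lambda>0$ and let $\{\tau_i\}$ be the points of a homogeneous Poisson point process on $\mathbb{R}$ with intensity $\lambda\,ds$. Let $g:\mathbb{R}\to\mathbb{R}$ be a measurable function in $L^1(\mathbb{R})$. For $t\in\mathbb{R}$ and $M>0$ put $$X(t)=\sum_i \beta_i\, g(t-\tau_i),\qquad X_M(t)=\sum_{i:\,|\tau_i|\le M}\beta_i\, g(t-\tau_i),\qquad \gamma_M=\#\{i:\ \tau_i\in[-M,M]\},$$ where $\beta_i=1$ almost surely for all $i$. Let $T>0$ and $a<b$, and assume that $g$ is of class $C^2$ on $[-T+a,T+b]$ (with one-sided derivatives at the endpoints) and that $$m=\min_{s\in[-T+a,T+b]}\sqrt{g'(s)^2+g''(s)^2}>0,\qquad n_0=\#\{s\in[-T+a,T+b]:\ g''(s)=0\}<\infty .$$ Let $k_0\ge 3$ be an integer. Then, for every $t\in\mathbb{R}$, the series $X(t)$ converges absolutely almost surely, and: 1. for all $t\in[a,b]$ and all $M\ge T$, the law of $X_M(t)$ conditionally on $\{\gamma_T\ge k_0\}$ has a continuous bounded density with respect to Lebesgue measure; 2. for all $t\in[a,b]$, the law of $X(t)$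 conditionally on $\{\gamma_T\ge k_0\}$ has a continuous bounded density; 3. more generally, for all $t\in\mathbb{R}$ and all $s\in[a,b]$, the law of $X(t)$ conditionally on $\{\#\{i:\ \tau_i\in[t-s-T,\,t-s+T]\}\ge k_0\}$ has a continuous bounded density. -/

import Mathlib

open MeasureTheory ProbabilityTheory Set
open scoped ENNReal NNReal

namespace ShotNoise

noncomputable section

/-- The number (possibly infinite) of indices `i` whose point `τ i ω` lies in `B`. -/
def count {ι Ω : Type*} (τ : ι → Ω → ℝ) (B : Set ℝ) (ω : Ω) : ℕ∞ :=
  {i | τ i ω ∈ B}.encard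

/-- The random points `τ i` form a Poisson point process on the line with intensity measure `ν`:
the number of points in a Borel set `B` is Poisson distributed with parameter `ν B` (and is a.s.
infinite if `ν B = ∞`), and the numbers of points in disjoint Borel sets are independent. -/
structure IsPoissonPointProcess {ι Ω : Type*} [MeasurableSpace Ω] (τ : ι → Ω → ℝ)
    (ν : Measure ℝ) (P : Measure Ω) : Prop where
  measurable : ∀ i, Measurable (τ i)
  count_law : ∀ B : Set ℝ, MeasurableSet B → ν B ≠ ∞ →
    HasLaw (count τ B) ((poissonMeasure (ν B).toNNReal).map (fun k : ℕ => (k : ℕ∞))) P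
  count_top : ∀ B : Set ℝ, MeasurableSet B → ν B = ∞ → ∀ᵐ ω ∂P, count τ B ω = ⊤
  indep : ∀ (n : ℕ) (B : Fin n → Set ℝ), (∀ j, MeasurableSet (B j)) →
    Pairwise (fun j k => Disjoint (B j) (B k)) → iIndepFun (fun j => count τ (B j)) P

/-- The shot noise process `X(t) = ∑ i, β i * g (t - τ i)`. -/
def shotNoise {ι Ω : Type*} (β : ι → Ω → ℝ) (g : ℝ → ℝ) (τ : ι → Ω → ℝ) (t : ℝ) (ω : Ω) : ℝ :=
  ∑' i, β i ω * g (t - τ i ω)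

/-- The truncated shot noise process `X_M(t)`: the sum is over the indices with `|τ i| ≤ M`. -/
def truncShotNoise {ι Ω : Type*} (β : ι → Ω → ℝ) (g : ℝ → ℝ) (τ : ι → Ω → ℝ) (M t : ℝ)
    (ω : Ω) : ℝ :=
  ∑' i : {i // |τ i ω| ≤ M}, β i ω * g (t - τ i ω)

/-- The law of the real random variable `Y` under `Q` has a continuous bounded density with
respect to Lebesgue measure. -/
def HasContinuousBoundedDensity {Ω : Type*} [MeasurableSpace Ω] (Y : Ω → ℝ) (Q : Measure Ω) :
    Prop :=
  ∃ f : ℝ → ℝ, Continuous f ∧ (∀ x, 0 ≤ f x) ∧ (∃ C, ∀ x, f x ≤ C) ∧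
    HasLaw Y (volume.withDensity (fun x => ENNReal.ofReal (f x))) Q

end

end ShotNoise

/-
Let `N` be the number of points in the window `W` and `J u = ∫_W exp (i u g (t - x)) dν`. Comparing
the coefficients of `z ^ k`, `|z| = 1`, in the characteristic functional
`E[exp (i u X) z ^ N] = A u * exp (z * J u)`, where `|A u| ≤ exp (-ν W)`, gives
`E[exp (i u X); N = k] = A u * J u ^ k / k!`, and summing over `k ≥ k₀` bounds
`|E[exp (i u X); N ≥ k₀]|` by `|J u| ^ k₀`.

Since `g'` and `g''` have no common zero, van der Corput's estimate gives `J u = O(|u| ^ (-1/2))`.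
To avoid cutting out the zeros of `h = g'`, we integrate by parts against `h / (h² + ε²)` in place
of `1 / h`, with `ε = |u| ^ (-1/2)`. Hence for `k₀ ≥ 3` the conditional characteristic function is
integrable, and Fourier inversion, justified by Gaussian regularisation, yields the density.
-/

namespace ShotNoise

section FourierInversion

open Filter Topology Real FourierTransform

/-- The inverse Fourier transform of the characteristic function of `μ`, the candidate for a
density of `μ`; the factor `2 * π` turns Mathlib's normalisation of `𝓕` into that of `charFun`. -/
noncomputable def fourierDensity (μ : Measure ℝ) (x : ℝ) : ℝ :=
  (𝓕 (fun ξ : ℝ => charFun μ (2 * π * ξ)) x).re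

lemma continuous_fourierDensity {μ : Measure ℝ} (hμ : Integrable (charFun μ)) :
    Continuous (fourierDensity μ) :=
  Complex.continuous_re.comp <| VectorFourier.fourierIntegral_continuous
    Real.continuous_fourierChar (L := innerₗ ℝ) continuous_inner (hμ.comp_mul_left' (by positivity))

lemma fourierDensity_le (μ : Measure ℝ) (x : ℝ) :
    fourierDensity μ x ≤ ∫ ξ : ℝ, ‖charFun μ (2 * π * ξ)‖ :=
  (Complex.re_le_norm _).trans (VectorFourier.norm_fourierIntegral_le_integral_norm _ _ _ _ _)

variable (μ : Measure ℝ) [IsFiniteMeasure μ]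

lemma fourier_charFun_mul {w : ℝ → ℂ} (hw : Integrable w) (x : ℝ) :
    𝓕 (fun ξ : ℝ => charFun μ (2 * π * ξ) * w ξ) x = ∫ y, 𝓕 w (x - y) ∂μ := by
  have hexp : ∀ ξ : ℝ, Complex.exp (((-2 * π * (x * ξ) : ℝ) : ℂ) * Complex.I) *
      (charFun μ (2 * π * ξ) * w ξ) =
      ∫ y, Complex.exp (((-2 * π * ((x - y) * ξ) : ℝ) : ℂ) * Complex.I) * w ξ ∂μ := by
    intro ξ
    rw [charFun_apply_real, integral_mul_const, ← mul_assoc, ← integral_const_mul]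
    refine congrArg (· * w ξ) (integral_congr_ae (ae_of_all _ fun y => ?_))
    dsimp only
    rw [← Complex.exp_add]
    push_cast
    ring_nf
  have hint : Integrable (Function.uncurry fun ξ y : ℝ =>
      Complex.exp (((-2 * π * ((x - y) * ξ) : ℝ) : ℂ) * Complex.I) * w ξ) (volume.prod μ) := by
    refine (hw.comp_fst μ).bdd_mul (c := 1) (by fun_prop) (ae_of_all _ fun p => ?_)
    rw [Complex.norm_exp_ofReal_mul_I]
  simp only [Real.fourier_eq', smul_eq_mul, RCLike.inner_apply, conj_trivial, hexp]
  exact integral_integral_swap hint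

variable {v : ℝ≥0}

lemma integrable_ofReal_exp_neg_mul_sq (hv : v ≠ 0) :
    Integrable fun ξ : ℝ => ((rexp (-(2 * π ^ 2 * v) * ξ ^ 2) : ℝ) : ℂ) :=
  (integrable_exp_neg_mul_sq (by positivity)).ofReal

lemma fourier_ofReal_exp_neg_mul_sq (hv : v ≠ 0) (x : ℝ) :
    𝓕 (fun ξ : ℝ => ((rexp (-(2 * π ^ 2 * v) * ξ ^ 2) : ℝ) : ℂ)) x = gaussianPDFReal 0 v x := by
  have hb : 0 < (((2 * π * v : ℝ)) : ℂ).re := by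
    rw [Complex.ofReal_re]
    positivity
  have hsqrt : (((2 * π * v : ℝ)) : ℂ) ^ (1 / 2 : ℂ) = ((√(2 * π * v) : ℝ) : ℂ) := by
    rw [Real.sqrt_eq_rpow, Complex.ofReal_cpow (by positivity)]
    norm_num
  have hv' : ((v : ℝ) : ℂ) ≠ 0 := by exact_mod_cast hv
  have hπ : (π : ℂ) ≠ 0 := by exact_mod_cast Real.pi_ne_zero
  convert congrFun (fourier_gaussian_pi hb) x using 1
  · refine congrArg (fun w : ℝ → ℂ => 𝓕 w x) (funext fun ξ => ?_)
    push_cast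
    ring_nf
  · rw [gaussianPDFReal, hsqrt]
    push_cast
    rw [one_div]
    congr 2
    field_simp
    ring

lemma fourier_charFun_mul_gaussian (hv : v ≠ 0) (x : ℝ) :
    𝓕 (fun ξ : ℝ => charFun μ (2 * π * ξ) * ((rexp (-(2 * π ^ 2 * v) * ξ ^ 2) : ℝ) : ℂ)) x =
      ((∫ y, gaussianPDFReal y v x ∂μ : ℝ) : ℂ) := by
  rw [fourier_charFun_mul μ (integrable_ofReal_exp_neg_mul_sq hv), ← integral_complex_ofReal]
  simp only [fourier_ofReal_exp_neg_mul_sq hv, gaussianPDFReal, sub_zero]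

lemma tendsto_fourier_mul_gaussian {φ : ℝ → ℂ} (hφ : Integrable φ) (x : ℝ) :
    Tendsto (fun v : ℝ≥0 => 𝓕 (fun ξ => φ ξ * ((rexp (-(2 * π ^ 2 * v) * ξ ^ 2) : ℝ) : ℂ)) x)
      (𝓝 0) (𝓝 (𝓕 φ x)) := by
  simp only [Real.fourier_eq', smul_eq_mul]
  refine tendsto_integral_filter_of_dominated_convergence (fun ξ => ‖φ ξ‖)
    (Eventually.of_forall fun v => ?_) (Eventually.of_forall fun v => ae_of_all _ fun ξ => ?_)
    hφ.norm (ae_of_all _ fun ξ => ?_)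
  · have := hφ.aestronglyMeasurable
    fun_prop
  · rw [norm_mul, Complex.norm_exp_ofReal_mul_I, one_mul, norm_mul, Complex.norm_real,
      Real.norm_eq_abs, abs_of_pos (Real.exp_pos _)]
    refine mul_le_of_le_one_right (norm_nonneg _) (Real.exp_le_one_iff.2 ?_)
    have : 0 ≤ 2 * π ^ 2 * (v : ℝ) * ξ ^ 2 := by positivity
    linarith
  · refine Continuous.tendsto' (by fun_prop) _ _ ?_
    simp

section IntegrableCharFun

variable {μ} (hμ : Integrable (charFun μ))
include hμ

lemma tendsto_integral_gaussianPDFReal (x : ℝ) :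
    Tendsto (fun v : ℝ≥0 => ((∫ y, gaussianPDFReal y v x ∂μ : ℝ) : ℂ)) (𝓝[≠] 0)
      (𝓝 (𝓕 (fun ξ : ℝ => charFun μ (2 * π * ξ)) x)) := by
  refine ((tendsto_fourier_mul_gaussian (hμ.comp_mul_left' (by positivity)) x).mono_left
    nhdsWithin_le_nhds).congr' ?_
  filter_upwards [self_mem_nhdsWithin] with v hv
  exact fourier_charFun_mul_gaussian μ hv x

lemma tendsto_integral_gaussianPDFReal_fourierDensity (x : ℝ) :
    Tendsto (fun v : ℝ≥0 => ∫ y, gaussianPDFReal y v x ∂μ) (𝓝[≠] 0)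
      (𝓝 (fourierDensity μ x)) :=
  (Complex.continuous_re.tendsto _).comp (tendsto_integral_gaussianPDFReal hμ x)

lemma ofReal_fourierDensity (x : ℝ) :
    (fourierDensity μ x : ℂ) = 𝓕 (fun ξ : ℝ => charFun μ (2 * π * ξ)) x :=
  tendsto_nhds_unique ((Complex.continuous_ofReal.tendsto _).comp
    (tendsto_integral_gaussianPDFReal_fourierDensity hμ x)) (tendsto_integral_gaussianPDFReal hμ x)

lemma fourierDensity_nonneg (x : ℝ) : 0 ≤ fourierDensity μ x :=
  ge_of_tendsto' (tendsto_integral_gaussianPDFReal_fourierDensity hμ x) fun v =>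
    integral_nonneg fun y => gaussianPDFReal_nonneg y v x

lemma lintegral_fourierDensity_le :
    ∫⁻ x, ENNReal.ofReal (fourierDensity μ x) ≤ μ univ := by
  obtain ⟨v, -, hv0, hv⟩ := exists_seq_strictAnti_tendsto (0 : ℝ≥0)
  have hvne : Tendsto v atTop (𝓝[≠] 0) :=
    tendsto_nhdsWithin_iff.2 ⟨hv, Eventually.of_forall fun n => (hv0 n).ne'⟩
  have hmeas : ∀ n, Measurable fun p : ℝ × ℝ => gaussianPDF p.2 (v n) p.1 := fun n => by
    unfold gaussianPDF gaussianPDFReal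
    fun_prop
  have hlim : ∀ x, ENNReal.ofReal (fourierDensity μ x) ≤
      liminf (fun n => ∫⁻ y, gaussianPDF y (v n) x ∂μ) atTop := by
    intro x
    have h := (ENNReal.continuous_ofReal.tendsto _).comp
      ((tendsto_integral_gaussianPDFReal_fourierDensity hμ x).comp hvne)
    rw [← h.liminf_eq]
    refine liminf_le_liminf (Eventually.of_forall fun n => ?_)
    calc ENNReal.ofReal (∫ y, gaussianPDFReal y (v n) x ∂μ)
        ≤ ‖∫ y, gaussianPDFReal y (v n) x ∂μ‖ₑ := Real.ofReal_le_enorm _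
      _ ≤ ∫⁻ y, ‖gaussianPDFReal y (v n) x‖ₑ ∂μ := enorm_integral_le_lintegral_enorm _
      _ = ∫⁻ y, gaussianPDF y (v n) x ∂μ :=
        lintegral_congr fun y => Real.enorm_of_nonneg (gaussianPDFReal_nonneg y (v n) x)
  calc ∫⁻ x, ENNReal.ofReal (fourierDensity μ x)
      ≤ ∫⁻ x, liminf (fun n => ∫⁻ y, gaussianPDF y (v n) x ∂μ) atTop := lintegral_mono hlim
    _ ≤ liminf (fun n => ∫⁻ x, ∫⁻ y, gaussianPDF y (v n) x ∂μ) atTop :=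
        lintegral_liminf_le fun n => (hmeas n).lintegral_prod_right'
    _ = liminf (fun n => ∫⁻ y, (∫⁻ x, gaussianPDF y (v n) x) ∂μ) atTop :=
        congrArg (liminf · atTop) <| funext fun n =>
          lintegral_lintegral_swap (f := fun x y => gaussianPDF y (v n) x) (hmeas n).aemeasurable
    _ = μ univ := by
        simp [lintegral_gaussianPDF_eq_one _ (hv0 _).ne']

lemma integrable_fourierDensity : Integrable (fourierDensity μ) := by
  refine ⟨(continuous_fourierDensity hμ).aestronglyMeasurable, ?_⟩
  rw [hasFiniteIntegral_iff_ofReal (ae_of_all _ (fourierDensity_nonneg hμ))]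
  exact (lintegral_fourierDensity_le hμ).trans_lt (measure_lt_top μ _)

lemma integral_cexp_mul_fourierDensity (t : ℝ) :
    ∫ x : ℝ, Complex.exp (t * x * Complex.I) * fourierDensity μ x = charFun μ t := by
  have hcont : Continuous fun ξ : ℝ => charFun μ (2 * π * ξ) :=
    continuous_charFun.comp (by fun_prop)
  have hint : Integrable (𝓕 fun ξ : ℝ => charFun μ (2 * π * ξ)) := by
    rw [← funext (ofReal_fourierDensity hμ)]
    exact (integrable_fourierDensity hμ).ofReal
  have hπ : (π : ℂ) ≠ 0 := by exact_mod_cast Real.pi_ne_zero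
  have hinv := congrFun (hcont.fourierInv_fourier_eq (hμ.comp_mul_left' (by positivity)) hint)
    (t / (2 * π))
  rw [Real.fourierInv_eq', mul_div_cancel₀ t (by positivity)] at hinv
  rw [← hinv]
  refine integral_congr_ae (ae_of_all _ fun x => ?_)
  dsimp only
  rw [ofReal_fourierDensity hμ, smul_eq_mul, RCLike.inner_apply, conj_trivial]
  push_cast
  field_simp

lemma withDensity_fourierDensity :
    volume.withDensity (fun x => ENNReal.ofReal (fourierDensity μ x)) = μ := by
  have := isFiniteMeasure_withDensity_ofReal (integrable_fourierDensity hμ).2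
  refine Measure.ext_of_charFun (funext fun t => ?_)
  have hmeas : Measurable fun x => ENNReal.ofReal (fourierDensity μ x) :=
    (continuous_fourierDensity hμ).measurable.ennreal_ofReal
  rw [← integral_cexp_mul_fourierDensity hμ, charFun_apply_real,
    integral_withDensity_eq_integral_toReal_smul hmeas (by simp)]
  refine integral_congr_ae (ae_of_all _ fun x => ?_)
  dsimp only
  rw [ENNReal.toReal_ofReal (fourierDensity_nonneg hμ x), Complex.real_smul, mul_comm]

end IntegrableCharFun

lemma HasContinuousBoundedDensity.of_integrable_charFun {Ω : Type*} [MeasurableSpace Ω]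
    {Q : Measure Ω} [IsFiniteMeasure Q] {Y : Ω → ℝ} (hY : AEMeasurable Y Q)
    (hint : Integrable (charFun (Q.map Y))) : HasContinuousBoundedDensity Y Q :=
  ⟨fourierDensity (Q.map Y), continuous_fourierDensity hint, fourierDensity_nonneg hint,
    ⟨_, fourierDensity_le _⟩, hY, (withDensity_fourierDensity hint).symm⟩

end FourierInversion

section OscillatoryIntegral

open Filter Topology Real

variable {p q : ℝ} {g h h₂ : ℝ → ℝ}

lemma continuousOn_div_sq_add_sq {s : Set ℝ} {k : ℝ → ℝ} {ε : ℝ} (hk : ContinuousOn k s)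
    (hh : ContinuousOn h s) (hε : 0 < ε) :
    ContinuousOn (fun x => k x / (h x ^ 2 + ε ^ 2)) s :=
  hk.div (by fun_prop) fun x _ => by positivity

lemma integral_deriv_mul_div_sq_add_sq_le (hpq : p ≤ q) (hh : ContinuousOn h (Icc p q))
    (hd : ∀ x ∈ Ioo p q, HasDerivAt h (h₂ x) x) (hh₂ : ContinuousOn h₂ (Icc p q))
    {ε : ℝ} (hε : 0 < ε) :
    ∫ x in p..q, h₂ x * ε / (h x ^ 2 + ε ^ 2) ≤ π := by
  have hderiv : ∀ x ∈ Ioo p q,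
      HasDerivAt (fun x => arctan (h x / ε)) (h₂ x * ε / (h x ^ 2 + ε ^ 2)) x := by
    intro x hx
    refine ((hd x hx).div_const ε).arctan.congr_deriv ?_
    field_simp
    ring
  rw [intervalIntegral.integral_eq_sub_of_hasDerivAt_of_le hpq
    (continuous_arctan.comp_continuousOn (hh.div_const ε)) hderiv
    ((continuousOn_div_sq_add_sq (by fun_prop) hh hε).intervalIntegrable_of_Icc hpq)]
  simp only [Function.comp_apply]
  linarith [arctan_lt_pi_div_two (h q / ε), neg_pi_div_two_lt_arctan (h p / ε)]

lemma setLIntegral_Icc_ofReal_eq {k : ℝ → ℝ} (hpq : p ≤ q) (hk : ContinuousOn k (Icc p q))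
    (hk0 : ∀ x, 0 ≤ k x) :
    ∫⁻ x in Icc p q, ENNReal.ofReal (k x) = ENNReal.ofReal (∫ x in p..q, k x) := by
  rw [intervalIntegral.integral_of_le hpq, ← integral_Icc_eq_integral_Ioc,
    ofReal_integral_eq_lintegral_ofReal (hk.integrableOn_compact isCompact_Icc) (ae_of_all _ hk0)]

lemma setLIntegral_div_sq_add_sq_le_of_le_deriv (hpq : p ≤ q) (hh : ContinuousOn h (Icc p q))
    (hd : ∀ x ∈ Ioo p q, HasDerivAt h (h₂ x) x) (hh₂ : ContinuousOn h₂ (Icc p q))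
    {δ ε : ℝ} (hδ : 0 < δ) (hε : 0 < ε) (hle : ∀ x ∈ Icc p q, δ ≤ h₂ x) :
    ∫⁻ x in Icc p q, ENNReal.ofReal (ε / (h x ^ 2 + ε ^ 2)) ≤ ENNReal.ofReal (π / δ) := by
  have hc : ContinuousOn (fun x => ε / (h x ^ 2 + ε ^ 2)) (Icc p q) :=
    continuousOn_div_sq_add_sq continuousOn_const hh hε
  rw [setLIntegral_Icc_ofReal_eq hpq hc fun x => by positivity]
  refine ENNReal.ofReal_le_ofReal ((le_div_iff₀' hδ).2 ?_)
  refine le_trans ?_ (integral_deriv_mul_div_sq_add_sq_le hpq hh hd hh₂ hε)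
  rw [← intervalIntegral.integral_const_mul]
  refine intervalIntegral.integral_mono_on hpq ((hc.intervalIntegrable_of_Icc hpq).const_mul _)
    ((continuousOn_div_sq_add_sq (by fun_prop) hh hε).intervalIntegrable_of_Icc hpq) fun x hx => ?_
  rw [← mul_div_assoc]
  gcongr
  exact hle x hx

lemma exists_setLIntegral_div_sq_add_sq_le_of_deriv_pos {x : ℝ} (hx : x ∈ Icc p q)
    (hh : ContinuousOn h (Icc p q)) (hd : ∀ x ∈ Ioo p q, HasDerivAt h (h₂ x) x)
    (hh₂ : ContinuousOn h₂ (Icc p q)) (hpos : 0 < h₂ x) :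
    ∃ t ∈ 𝓝[Icc p q] x, ∃ C : ℝ≥0, ∀ ε : ℝ, 0 < ε →
      ∫⁻ y in t, ENNReal.ofReal (ε / (h y ^ 2 + ε ^ 2)) ≤ C := by
  have hev : ∀ᶠ y in 𝓝[Icc p q] x, h₂ x / 2 < h₂ y :=
    (hh₂ x hx).eventually (lt_mem_nhds (half_lt_self hpos))
  obtain ⟨r, hr, hball⟩ :=
    (nhdsWithin_hasBasis Metric.nhds_basis_closedBall (Icc p q)).mem_iff.1 hev
  have hIcc : Metric.closedBall x r ∩ Icc p q = Icc (max (x - r) p) (min (x + r) q) := by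
    rw [Real.closedBall_eq_Icc, Icc_inter_Icc]
  have hsub : Icc (max (x - r) p) (min (x + r) q) ⊆ Icc p q := hIcc ▸ inter_subset_right
  refine ⟨Metric.closedBall x r ∩ Icc p q,
    inter_mem (mem_nhdsWithin_of_mem_nhds (Metric.closedBall_mem_nhds x hr)) self_mem_nhdsWithin,
    (π / (h₂ x / 2)).toNNReal, fun ε hε => ?_⟩
  rw [hIcc]
  refine setLIntegral_div_sq_add_sq_le_of_le_deriv ?_ (hh.mono hsub) (fun y hy => hd y ?_)
    (hh₂.mono hsub) (half_pos hpos) hε fun y hy => ?_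
  · exact (max_le (by linarith) hx.1).trans (le_min (by linarith) hx.2)
  · exact ⟨(le_max_right _ _).trans_lt hy.1, hy.2.trans_le (min_le_right _ _)⟩
  · exact le_of_lt (hball (hIcc ▸ hy))

lemma exists_setLIntegral_div_sq_add_sq_le_of_ne_zero {x : ℝ} (hx : x ∈ Icc p q)
    (hh : ContinuousOn h (Icc p q)) (h0 : h x ≠ 0) :
    ∃ t ∈ 𝓝[Icc p q] x, ∃ C : ℝ≥0, ∀ ε : ℝ, 0 < ε →
      ∫⁻ y in t, ENNReal.ofReal (ε / (h y ^ 2 + ε ^ 2)) ≤ C := by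
  have habs : 0 < |h x| := abs_pos.2 h0
  have hev : ∀ᶠ y in 𝓝[Icc p q] x, |h x| / 2 < |h y| :=
    (hh x hx).abs.eventually (lt_mem_nhds (half_lt_self habs))
  refine ⟨{y | |h x| / 2 < |h y|} ∩ Icc p q, inter_mem hev self_mem_nhdsWithin,
    (1 / |h x|).toNNReal * (q - p).toNNReal, fun ε hε => ?_⟩
  -- AM-GM: `2 * |h y| * ε ≤ h y ^ 2 + ε ^ 2`.
  have hle : ∀ y ∈ {y | |h x| / 2 < |h y|} ∩ Icc p q,
      ENNReal.ofReal (ε / (h y ^ 2 + ε ^ 2)) ≤ ENNReal.ofReal (1 / |h x|) := by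
    rintro y ⟨hy : |h x| / 2 < |h y|, -⟩
    refine ENNReal.ofReal_le_ofReal ?_
    rw [div_le_div_iff₀ (by positivity) habs]
    nlinarith [sq_nonneg (|h y| - ε), sq_abs (h y)]
  calc ∫⁻ y in {y | |h x| / 2 < |h y|} ∩ Icc p q, ENNReal.ofReal (ε / (h y ^ 2 + ε ^ 2))
      ≤ ∫⁻ _ in {y | |h x| / 2 < |h y|} ∩ Icc p q, ENNReal.ofReal (1 / |h x|) :=
        setLIntegral_mono measurable_const hle
    _ ≤ ENNReal.ofReal (1 / |h x|) * volume (Icc p q) := by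
        rw [setLIntegral_const]
        gcongr
        exact inter_subset_right
    _ = ((1 / |h x|).toNNReal * (q - p).toNNReal : ℝ≥0) := by
        rw [Real.volume_Icc, ENNReal.coe_mul]
        rfl

/-- A smoothed form of the bound `O(ε)` for the measure of the sublevel set `{|h| ≤ ε}`. -/
lemma exists_setLIntegral_div_sq_add_sq_le (hh : ContinuousOn h (Icc p q))
    (hd : ∀ x ∈ Ioo p q, HasDerivAt h (h₂ x) x) (hh₂ : ContinuousOn h₂ (Icc p q))
    (hne : ∀ x ∈ Icc p q, h x = 0 → h₂ x ≠ 0) :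
    ∃ C : ℝ≥0, ∀ ε : ℝ, 0 < ε →
      ∫⁻ x in Icc p q, ENNReal.ofReal (ε / (h x ^ 2 + ε ^ 2)) ≤ C := by
  refine isCompact_Icc.induction_on (p := fun t => ∃ C : ℝ≥0, ∀ ε : ℝ, 0 < ε →
    ∫⁻ x in t, ENNReal.ofReal (ε / (h x ^ 2 + ε ^ 2)) ≤ C) ⟨0, by simp⟩ ?_ ?_ ?_
  · rintro s t hst ⟨C, hC⟩
    exact ⟨C, fun ε hε => (lintegral_mono_set hst).trans (hC ε hε)⟩
  · rintro s t ⟨C, hC⟩ ⟨D, hD⟩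
    exact ⟨C + D, fun ε hε => (lintegral_union_le _ s t).trans (add_le_add (hC ε hε) (hD ε hε))⟩
  · intro x hx
    by_cases h0 : h x = 0
    · rcases (hne x hx h0).lt_or_gt with hneg | hpos
      · simpa only [Pi.neg_apply, neg_sq] using
          exists_setLIntegral_div_sq_add_sq_le_of_deriv_pos hx hh.neg
            (fun y hy => (hd y hy).neg) hh₂.neg (neg_pos.2 hneg)
      · exact exists_setLIntegral_div_sq_add_sq_le_of_deriv_pos hx hh hd hh₂ hpos
    · exact exists_setLIntegral_div_sq_add_sq_le_of_ne_zero hx hh h0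

lemma norm_cexp_ofReal_mul_ofReal_mul_I (u x : ℝ) : ‖Complex.exp (u * x * Complex.I)‖ = 1 := by
  rw [← Complex.ofReal_mul, Complex.norm_exp_ofReal_mul_I]

lemma mul_integral_cexp_eq {ψ ψ' : ℝ → ℝ} (hpq : p ≤ q) (hgc : ContinuousOn g (Icc p q))
    (hgd : ∀ x ∈ Ioo p q, HasDerivAt g (h x) x) (hh : ContinuousOn h (Icc p q))
    (hψ : ContinuousOn ψ (Icc p q)) (hψd : ∀ x ∈ Ioo p q, HasDerivAt ψ (ψ' x) x)
    (hψ' : ContinuousOn ψ' (Icc p q)) (u : ℝ) :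
    u * Complex.I * ∫ x in p..q, Complex.exp (u * g x * Complex.I) =
      Complex.exp (u * g q * Complex.I) * ψ q - Complex.exp (u * g p * Complex.I) * ψ p +
      ∫ x in p..q, Complex.exp (u * g x * Complex.I) *
        (u * (1 - h x * ψ x : ℝ) * Complex.I - ψ' x) := by
  have hcoe : ∀ {k : ℝ → ℝ}, ContinuousOn k (Icc p q) →
      ContinuousOn (fun x => (k x : ℂ)) (Icc p q) :=
    fun hk => Complex.continuous_ofReal.comp_continuousOn hk
  have := hcoe hgc
  have := hcoe hh
  have hψC := hcoe hψ
  have hψC' := hcoe hψ'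
  have hE : ContinuousOn (fun x => Complex.exp (u * g x * Complex.I)) (Icc p q) :=
    Complex.continuous_exp.comp_continuousOn (by fun_prop)
  have hEd : ∀ x ∈ Ioo p q, HasDerivAt (fun x => Complex.exp (u * g x * Complex.I))
      (Complex.exp (u * g x * Complex.I) * (u * h x * Complex.I)) x := fun x hx =>
    ((((hgd x hx).ofReal_comp).const_mul (u : ℂ)).mul_const Complex.I).cexp
  have hR : ContinuousOn (fun x => Complex.exp (u * g x * Complex.I) *
      (u * (1 - h x * ψ x : ℝ) * Complex.I - ψ' x)) (Icc p q) := by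
    push_cast
    fun_prop
  have hftc := intervalIntegral.integral_eq_sub_of_hasDerivAt_of_le hpq (hE.mul hψC)
    (fun x hx => (hEd x hx).mul (hψd x hx).ofReal_comp)
    (ContinuousOn.intervalIntegrable_of_Icc hpq (by fun_prop))
  simp only [Pi.mul_apply] at hftc
  rw [← hftc, ← intervalIntegral.integral_const_mul, ← intervalIntegral.integral_add
    (ContinuousOn.intervalIntegrable_of_Icc hpq (by fun_prop)) (hR.intervalIntegrable_of_Icc hpq)]
  refine intervalIntegral.integral_congr fun x _ => ?_
  push_cast
  ring

lemma abs_mul_norm_integral_cexp_le {ψ ψ' : ℝ → ℝ} (hpq : p ≤ q) (hgc : ContinuousOn g (Icc p q))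
    (hgd : ∀ x ∈ Ioo p q, HasDerivAt g (h x) x) (hh : ContinuousOn h (Icc p q))
    (hψ : ContinuousOn ψ (Icc p q)) (hψd : ∀ x ∈ Ioo p q, HasDerivAt ψ (ψ' x) x)
    (hψ' : ContinuousOn ψ' (Icc p q)) (u : ℝ) :
    |u| * ‖∫ x in p..q, Complex.exp (u * g x * Complex.I)‖ ≤
      |ψ q| + |ψ p| + ∫ x in p..q, (|u| * |1 - h x * ψ x| + |ψ' x|) := by
  have hn : |u| * ‖∫ x in p..q, Complex.exp (u * g x * Complex.I)‖ =
      ‖u * Complex.I * ∫ x in p..q, Complex.exp (u * g x * Complex.I)‖ := by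
    simp
  rw [hn, mul_integral_cexp_eq hpq hgc hgd hh hψ hψd hψ']
  refine (norm_add_le _ _).trans (add_le_add ((norm_sub_le _ _).trans_eq ?_)
    (intervalIntegral.norm_integral_le_of_norm_le hpq (ae_of_all _ fun x _ => ?_)
      (ContinuousOn.intervalIntegrable_of_Icc hpq (by fun_prop))))
  · simp [norm_cexp_ofReal_mul_ofReal_mul_I]
  · rw [norm_mul, norm_cexp_ofReal_mul_ofReal_mul_I, one_mul]
    refine (norm_sub_le _ _).trans_eq ?_
    simp only [norm_mul, Complex.norm_real, Complex.norm_I, mul_one, Real.norm_eq_abs]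

lemma abs_div_sq_add_sq_le (y : ℝ) {ε : ℝ} (hε : 0 < ε) : |y / (y ^ 2 + ε ^ 2)| ≤ 1 / (2 * ε) := by
  rw [abs_div, abs_of_pos (a := y ^ 2 + ε ^ 2) (by positivity),
    div_le_div_iff₀ (by positivity) (by positivity)]
  nlinarith [sq_nonneg (|y| - ε), sq_abs y]

lemma hasDerivAt_div_sq_add_sq {x k' ε : ℝ} {k : ℝ → ℝ} (hk : HasDerivAt k k' x) (hε : 0 < ε) :
    HasDerivAt (fun x => k x / (k x ^ 2 + ε ^ 2))
      (k' * (ε ^ 2 - k x ^ 2) / (k x ^ 2 + ε ^ 2) ^ 2) x := by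
  have hpos : k x ^ 2 + ε ^ 2 ≠ 0 := by positivity
  refine (hk.div ((hk.pow 2).add_const (ε ^ 2)) hpos).congr_deriv ?_
  simp only [Pi.pow_apply]
  ring

lemma abs_mul_sub_div_sq_add_sq_le {y y' K ε : ℝ} (hK : |y'| ≤ K) (hε : 0 < ε) :
    |y' * (ε ^ 2 - y ^ 2) / (y ^ 2 + ε ^ 2) ^ 2| ≤ K / ε * (ε / (y ^ 2 + ε ^ 2)) := by
  have hle : |ε ^ 2 - y ^ 2| ≤ y ^ 2 + ε ^ 2 :=
    abs_le.2 ⟨by nlinarith [sq_nonneg ε], by nlinarith [sq_nonneg y]⟩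
  calc |y' * (ε ^ 2 - y ^ 2) / (y ^ 2 + ε ^ 2) ^ 2|
      = |y'| * |ε ^ 2 - y ^ 2| / (y ^ 2 + ε ^ 2) ^ 2 := by
        rw [abs_div, abs_mul, abs_of_nonneg (a := (y ^ 2 + ε ^ 2) ^ 2) (by positivity)]
    _ ≤ K * (y ^ 2 + ε ^ 2) / (y ^ 2 + ε ^ 2) ^ 2 := by
        gcongr
        exact (abs_nonneg _).trans hK
    _ = K / ε * (ε / (y ^ 2 + ε ^ 2)) := by field_simp

lemma abs_mul_norm_integral_cexp_le_of_integral_div_le (hpq : p ≤ q)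
    (hgc : ContinuousOn g (Icc p q)) (hgd : ∀ x ∈ Ioo p q, HasDerivAt g (h x) x)
    (hh : ContinuousOn h (Icc p q)) (hd : ∀ x ∈ Ioo p q, HasDerivAt h (h₂ x) x)
    (hh₂ : ContinuousOn h₂ (Icc p q)) {K C ε : ℝ} (hK : ∀ x ∈ Icc p q, |h₂ x| ≤ K) (hε : 0 < ε)
    (hC : ∫ x in p..q, ε / (h x ^ 2 + ε ^ 2) ≤ C) (u : ℝ) :
    |u| * ‖∫ x in p..q, Complex.exp (u * g x * Complex.I)‖ ≤ 1 / ε + (|u| * ε + K / ε) * C := by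
  have hK0 : 0 ≤ K := (abs_nonneg _).trans (hK p ⟨le_rfl, hpq⟩)
  have hψ : ContinuousOn (fun x => h x / (h x ^ 2 + ε ^ 2)) (Icc p q) :=
    continuousOn_div_sq_add_sq hh hh hε
  have hψ' : ContinuousOn (fun x => h₂ x * (ε ^ 2 - h x ^ 2) / (h x ^ 2 + ε ^ 2) ^ 2) (Icc p q) :=
    ContinuousOn.div (by fun_prop) (by fun_prop) fun x _ => by positivity
  refine (abs_mul_norm_integral_cexp_le hpq hgc hgd hh hψ
    (fun x hx => hasDerivAt_div_sq_add_sq (hd x hx) hε) hψ' u).trans (add_le_add ?_ ?_)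
  · calc _ ≤ 1 / (2 * ε) + 1 / (2 * ε) :=
          add_le_add (abs_div_sq_add_sq_le _ hε) (abs_div_sq_add_sq_le _ hε)
      _ = 1 / ε := by field_simp; norm_num
  · have hrem : ∀ x, |1 - h x * (h x / (h x ^ 2 + ε ^ 2))| = ε * (ε / (h x ^ 2 + ε ^ 2)) := by
      intro x
      rw [← abs_of_nonneg (a := ε * (ε / (h x ^ 2 + ε ^ 2))) (by positivity)]
      congr 1
      field_simp
      ring
    refine le_trans ?_ (mul_le_mul_of_nonneg_left hC (by positivity))
    rw [← intervalIntegral.integral_const_mul]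
    refine intervalIntegral.integral_mono_on hpq
      (ContinuousOn.intervalIntegrable_of_Icc hpq (by fun_prop))
      (((continuousOn_div_sq_add_sq continuousOn_const hh hε).intervalIntegrable_of_Icc
        hpq).const_mul _) fun x hx => ?_
    rw [hrem, add_mul, mul_assoc]
    gcongr
    exact abs_mul_sub_div_sq_add_sq_le (hK x hx) hε

theorem exists_sqrt_mul_norm_integral_cexp_le (hpq : p ≤ q) (hgc : ContinuousOn g (Icc p q))
    (hgd : ∀ x ∈ Ioo p q, HasDerivAt g (h x) x) (hh : ContinuousOn h (Icc p q))
    (hd : ∀ x ∈ Ioo p q, HasDerivAt h (h₂ x) x) (hh₂ : ContinuousOn h₂ (Icc p q))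
    (hne : ∀ x ∈ Icc p q, h x = 0 → h₂ x ≠ 0) :
    ∃ D : ℝ, ∀ u : ℝ, √|u| * ‖∫ x in p..q, Complex.exp (u * g x * Complex.I)‖ ≤ D := by
  obtain ⟨C, hC⟩ := exists_setLIntegral_div_sq_add_sq_le hh hd hh₂ hne
  obtain ⟨K, hK⟩ := isCompact_Icc.exists_bound_of_continuousOn hh₂
  have hK0 : 0 ≤ K := (norm_nonneg _).trans (hK p ⟨le_rfl, hpq⟩)
  refine ⟨1 + (1 + K) * C, fun u => ?_⟩
  rcases eq_or_ne u 0 with rfl | hu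
  · simp only [abs_zero, sqrt_zero, zero_mul]
    positivity
  have hs : 0 < √|u| := sqrt_pos.2 (abs_pos.2 hu)
  have hε : 0 < 1 / √|u| := by positivity
  have hint : ∫ x in p..q, 1 / √|u| / (h x ^ 2 + (1 / √|u|) ^ 2) ≤ (C : ℝ) := by
    rw [← ENNReal.ofReal_le_ofReal_iff C.coe_nonneg, ENNReal.ofReal_coe_nnreal,
      ← setLIntegral_Icc_ofReal_eq hpq (continuousOn_div_sq_add_sq continuousOn_const hh hε)
        fun x => by positivity]
    exact hC _ hε
  refine le_of_mul_le_mul_left ?_ hs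
  calc √|u| * (√|u| * ‖∫ x in p..q, Complex.exp (u * g x * Complex.I)‖)
      = |u| * ‖∫ x in p..q, Complex.exp (u * g x * Complex.I)‖ := by
        rw [← mul_assoc, mul_self_sqrt (abs_nonneg u)]
    _ ≤ 1 / (1 / √|u|) + (|u| * (1 / √|u|) + K / (1 / √|u|)) * C :=
        abs_mul_norm_integral_cexp_le_of_integral_div_le hpq hgc hgd hh hd hh₂ hK hε hint u
    _ = √|u| * (1 + (1 + K) * C) := by
        rw [mul_one_div |u|, div_sqrt]
        field_simp

end OscillatoryIntegral

section PowerSeriesOnCircle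

open Real

lemma integral_cexp_intCast_mul_I (m : ℤ) :
    ∫ θ in (0 : ℝ)..2 * π, Complex.exp (m * θ * Complex.I) = if m = 0 then 2 * (π : ℂ) else 0 := by
  split_ifs with hm
  · simp [hm]
  · have hc : (m : ℂ) * Complex.I ≠ 0 := mul_ne_zero (mod_cast hm) Complex.I_ne_zero
    have hper : Complex.exp (m * Complex.I * (2 * π : ℝ)) = 1 := by
      rw [← Complex.exp_int_mul_two_pi_mul_I m]
      push_cast
      ring_nf
    simp only [mul_right_comm (m : ℂ) _ Complex.I]
    rw [integral_exp_mul_complex hc, hper]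
    simp

lemma integral_tsum_mul_cexp_pow {a : ℕ → ℂ} (ha : Summable a) (k : ℕ) :
    ∫ θ in (0 : ℝ)..2 * π, (∑' n, a n * Complex.exp (θ * Complex.I) ^ n) *
      Complex.exp (-k * θ * Complex.I) = 2 * π * a k := by
  set F : ℕ → ℝ → ℂ := fun n θ => a n * Complex.exp (((n : ℤ) - k : ℤ) * θ * Complex.I)
  have hF : ∀ θ : ℝ, (∑' n, a n * Complex.exp (θ * Complex.I) ^ n) *
      Complex.exp (-k * θ * Complex.I) = ∑' n, F n θ := fun θ => by
    rw [← tsum_mul_right]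
    refine tsum_congr fun n => ?_
    simp only [F]
    rw [mul_assoc, ← Complex.exp_nat_mul, ← Complex.exp_add]
    push_cast
    ring_nf
  have hnorm : ∀ n θ, ‖F n θ‖ = ‖a n‖ := fun n θ => by
    simp only [F]
    rw [norm_mul, ← Complex.ofReal_intCast, ← Complex.ofReal_mul, Complex.norm_exp_ofReal_mul_I,
      mul_one]
  have hsum := hasSum_integral_of_summable_integral_norm (μ := volume.restrict (Ioc 0 (2 * π)))
    (F := F) (fun n => Continuous.integrableOn_Ioc (by fun_prop)) (by
      simp only [hnorm, integral_const]
      exact ha.norm.const_smul _)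
  have hterm : ∀ n, ∫ θ in Ioc 0 (2 * π), F n θ = if n = k then 2 * π * a k else 0 := fun n => by
    rw [← intervalIntegral.integral_of_le (by positivity), intervalIntegral.integral_const_mul,
      integral_cexp_intCast_mul_I]
    simp only [sub_eq_zero, Nat.cast_inj, mul_ite, mul_zero]
    split_ifs with h
    · rw [h, mul_comm]
    · rfl
  simp only [hF]
  rw [intervalIntegral.integral_of_le (by positivity), ← hsum.tsum_eq]
  simp only [hterm, tsum_ite_eq]

lemma eq_of_tsum_mul_cexp_pow_eq {a b : ℕ → ℂ} (ha : Summable a) (hb : Summable b)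
    (h : ∀ θ : ℝ, ∑' n, a n * Complex.exp (θ * Complex.I) ^ n =
      ∑' n, b n * Complex.exp (θ * Complex.I) ^ n) : a = b := by
  funext k
  have hk := integral_tsum_mul_cexp_pow ha k
  simp only [h, integral_tsum_mul_cexp_pow hb k] at hk
  exact (mul_left_cancel₀ (mul_ne_zero two_ne_zero (mod_cast pi_ne_zero)) hk).symm

end PowerSeriesOnCircle

section PoissonPointProcess

open Filter Topology

lemma lintegral_natCast_poissonMeasure (r : ℝ≥0) : ∫⁻ n, (n : ℝ≥0∞) ∂(poissonMeasure r) = r := by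
  have hsucc : ∀ n : ℕ, ((n + 1 : ℕ) : ℝ≥0∞) * poissonMeasure r {n + 1} =
      r * poissonMeasure r {n} := fun n => by
    rw [poissonMeasure_singleton, poissonMeasure_singleton, ← ENNReal.ofReal_natCast,
      ← ENNReal.ofReal_coe_nnreal, ← ENNReal.ofReal_mul (by positivity),
      ← ENNReal.ofReal_mul (by positivity), Nat.factorial_succ]
    congr 1
    push_cast
    field_simp
    ring
  have htotal : ∑' n, poissonMeasure r {n} = 1 := by
    simpa using (lintegral_countable' (μ := poissonMeasure r) fun _ => 1).symm
  rw [lintegral_countable', tsum_eq_zero_add' ENNReal.summable]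
  simp only [hsucc, ENNReal.tsum_mul_left, htotal, Nat.cast_zero, zero_mul, zero_add, mul_one]

lemma integrable_cexp_ofReal_mul_I {α : Type*} [MeasurableSpace α] {μ : Measure α}
    [IsFiniteMeasure μ] {Y : α → ℝ} (hY : AEMeasurable Y μ) :
    Integrable (fun x => Complex.exp (Y x * Complex.I)) μ :=
  .of_bound (by fun_prop) 1 (ae_of_all _ fun x => (Complex.norm_exp_ofReal_mul_I _).le)

lemma integrable_cexp_ofReal_mul_I_sub_one {α : Type*} [MeasurableSpace α] {μ : Measure α}
    {Y : α → ℝ} (hY : Integrable Y μ) :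
    Integrable (fun x => Complex.exp (Y x * Complex.I) - 1) μ := by
  have := hY.aemeasurable
  refine hY.mono (by fun_prop) (ae_of_all _ fun x => ?_)
  rw [mul_comm]
  exact Real.norm_exp_I_mul_ofReal_sub_one_le

lemma integral_cexp_add_indicator_sub_one {α : Type*} [MeasurableSpace α] {μ : Measure α}
    {f : α → ℝ} (hf : Integrable f μ) {W : Set α} (hW : MeasurableSet W) (hμ : μ W ≠ ∞) (θ : ℝ) :
    ∫ x, (Complex.exp ((f x + W.indicator (fun _ => θ) x : ℝ) * Complex.I) - 1) ∂μ =
      Complex.exp (θ * Complex.I) * ∫ x in W, Complex.exp (f x * Complex.I) ∂μ +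
        (∫ x in Wᶜ, (Complex.exp (f x * Complex.I) - 1) ∂μ - μ.real W) := by
  have : IsFiniteMeasure (μ.restrict W) := isFiniteMeasure_restrict.2 hμ
  set h : α → ℝ := fun x => f x + W.indicator (fun _ => θ) x
  have hh : Integrable h μ := hf.add ((integrable_indicator_iff hW).2 (integrable_const θ))
  have hin : ∫ x in W, (Complex.exp (h x * Complex.I) - 1) ∂μ =
      Complex.exp (θ * Complex.I) * ∫ x in W, Complex.exp (f x * Complex.I) ∂μ - μ.real W := by
    have hcongr : EqOn (fun x => Complex.exp (h x * Complex.I) - 1)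
        (fun x => Complex.exp (θ * Complex.I) * Complex.exp (f x * Complex.I) - 1) W :=
      fun x hx => by
        simp only [h, indicator_of_mem hx, Complex.ofReal_add, add_mul, Complex.exp_add]
        rw [mul_comm (Complex.exp (f x * Complex.I))]
    rw [setIntegral_congr_fun hW hcongr, integral_sub ((integrable_cexp_ofReal_mul_I
      hf.aemeasurable.restrict).const_mul _) (integrable_const _), integral_const_mul]
    simp
  have hout : ∫ x in Wᶜ, (Complex.exp (h x * Complex.I) - 1) ∂μ =
      ∫ x in Wᶜ, (Complex.exp (f x * Complex.I) - 1) ∂μ :=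
    setIntegral_congr_fun hW.compl fun x hx => by
      simp only [h, indicator_of_notMem hx, add_zero]
  rw [← integral_add_compl hW (integrable_cexp_ofReal_mul_I_sub_one hh), hin, hout]
  ring

variable {ι Ω : Type*} {τ : ι → Ω → ℝ}

lemma count_eq_tsum (B : Set ℝ) (ω : Ω) :
    (count τ B ω : ℝ≥0∞) = ∑' i, B.indicator (fun _ => (1 : ℝ≥0∞)) (τ i ω) := by
  rw [count, ← ENNReal.tsum_set_one, tsum_subtype {i | τ i ω ∈ B} fun _ => (1 : ℝ≥0∞)]
  rfl

lemma hasSum_indicator_count {B : Set ℝ} {ω : Ω} (h : count τ B ω ≠ ⊤) (c : ℝ) :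
    HasSum (fun i => B.indicator (fun _ => c) (τ i ω)) (c * (count τ B ω).toNat) := by
  have hf : {i | τ i ω ∈ B}.Finite := Set.encard_ne_top_iff.1 h
  convert! hasSum_sum_of_ne_finset_zero (L := .unconditional ι) (s := hf.toFinset)
    fun i hi => indicator_of_notMem (f := fun _ => c) (by simpa using hi) using 1
  rw [Finset.sum_congr rfl fun i hi => indicator_of_mem (by simpa using hi) _,
    Finset.sum_const, nsmul_eq_mul, mul_comm, count, hf.encard_eq_coe_toFinset_card,
    ENat.toNat_natCast]

variable [MeasurableSpace Ω] {ν : Measure ℝ} {P : Measure Ω}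

lemma hasSum_setIntegral_eq_natCast {N : Ω → ℕ∞} (hN : Measurable N) (hfin : ∀ᵐ ω ∂P, N ω ≠ ⊤)
    {Y : Ω → ℂ} (hY : Integrable Y P) (k₀ : ℕ) :
    HasSum (fun j => ∫ ω in {ω | N ω = (j + k₀ : ℕ)}, Y ω ∂P)
      (∫ ω in {ω | (k₀ : ℕ∞) ≤ N ω}, Y ω ∂P) := by
  have hset : ({ω | (k₀ : ℕ∞) ≤ N ω} : Set Ω) =ᵐ[P] ⋃ j : ℕ, {ω | N ω = (j + k₀ : ℕ)} := by
    filter_upwards [hfin] with ω hω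
    refine propext ?_
    change (k₀ : ℕ∞) ≤ N ω ↔ ω ∈ ⋃ j : ℕ, {ω | N ω = (j + k₀ : ℕ)}
    obtain ⟨n, hn⟩ := ENat.ne_top_iff_exists.1 hω
    simp only [mem_iUnion, mem_ofPred_eq, ← hn, Nat.cast_le, Nat.cast_inj]
    exact le_iff_exists_add'
  rw [setIntegral_congr_set hset]
  refine hasSum_integral_iUnion (fun j => hN (measurableSet_singleton _)) ?_ hY.integrableOn
  intro j k hjk
  refine disjoint_left.2 fun ω hj hk => hjk ?_
  exact Nat.add_right_cancel (Nat.cast_injective (hj.symm.trans hk))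

lemma hasSum_setIntegral_eq_natCast_mul_pow {N : Ω → ℕ∞} (hN : Measurable N)
    (hfin : ∀ᵐ ω ∂P, N ω ≠ ⊤) {Y : Ω → ℂ} (hY : Integrable Y P) {z : ℂ} (hz : ‖z‖ ≤ 1) :
    HasSum (fun n : ℕ => (∫ ω in {ω | N ω = n}, Y ω ∂P) * z ^ n)
      (∫ ω, Y ω * z ^ (N ω).toNat ∂P) := by
  have hint : Integrable (fun ω => Y ω * z ^ (N ω).toNat) P := by
    refine hY.mul_bdd (c := 1) ?_ (ae_of_all _ fun ω => ?_)
    · exact ((Measurable.of_discrete (f := fun n : ℕ∞ => z ^ n.toNat)).comp hN).aestronglyMeasurable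
    · rw [norm_pow]
      exact pow_le_one₀ (norm_nonneg z) hz
  convert! hasSum_setIntegral_eq_natCast hN hfin hint 0 using 1
  · funext n
    rw [← integral_mul_const, add_zero]
    refine setIntegral_congr_fun (hN (measurableSet_singleton _)) fun ω hω => ?_
    simp only [mem_ofPred_eq] at hω
    simp only [hω, ENat.toNat_natCast]
  · simp

namespace IsPoissonPointProcess

lemma ae_count_ne_top (hτ : IsPoissonPointProcess τ ν P) {B : Set ℝ} (hB : MeasurableSet B)
    (hν : ν B ≠ ∞) : ∀ᵐ ω ∂P, count τ B ω ≠ ⊤ := by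
  have hlaw := hτ.count_law B hB hν
  have hmap : ∀ᵐ x ∂P.map (count τ B), x ≠ ⊤ := by
    rw [hlaw.map_eq, ae_map_iff (by fun_prop) (by measurability)]
    simp
  exact ae_of_ae_map hlaw.aemeasurable hmap

lemma iIndepFun_count (hτ : IsPoissonPointProcess τ ν P) {κ : Type*} [Finite κ]
    {B : κ → Set ℝ} (hBm : ∀ j, MeasurableSet (B j))
    (hB : Pairwise (fun j k => Disjoint (B j) (B k))) : iIndepFun (fun j => count τ (B j)) P := by
  let e := Finite.equivFin κ
  simpa using (hτ.indep _ (fun j => B (e.symm j)) (fun j => hBm _)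
    fun j k hjk => hB (e.symm.injective.ne hjk)).precomp e.injective

lemma integral_cexp_mul_count (hτ : IsPoissonPointProcess τ ν P) {B : Set ℝ}
    (hB : MeasurableSet B) (hν : ν B ≠ ∞) (c : ℝ) :
    ∫ ω, Complex.exp (c * (count τ B ω).toNat * Complex.I) ∂P =
      Complex.exp (ν.real B * (Complex.exp (c * Complex.I) - 1)) := by
  have hlaw := (hτ.count_law B hB hν).integral_comp
    (f := fun n : ℕ∞ => Complex.exp (c * n.toNat * Complex.I))
    Measurable.of_discrete.aestronglyMeasurable
  have hchar := charFun_map_cast_poissonMeasure (ν B).toNNReal c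
  rw [charFun_apply_real, integral_map .of_discrete (by fun_prop)] at hchar
  simp only [Function.comp_def] at hlaw
  rw [hlaw, integral_map Measurable.of_discrete.aemeasurable
    Measurable.of_discrete.aestronglyMeasurable]
  simpa [measureReal_def, ENNReal.coe_toNNReal_eq_toReal] using hchar

lemma lintegral_count [IsProbabilityMeasure P] (hτ : IsPoissonPointProcess τ ν P)
    {B : Set ℝ} (hB : MeasurableSet B) :
    ∫⁻ ω, (count τ B ω : ℝ≥0∞) ∂P = ν B := by
  by_cases hν : ν B = ∞
  · rw [lintegral_congr_ae (g := fun _ => ∞)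
      ((hτ.count_top B hB hν).mono fun ω h => by simp [h]), hν]
    simp
  · rw [(hτ.count_law B hB hν).lintegral_comp (f := fun x : ℕ∞ => (x : ℝ≥0∞))
      Measurable.of_discrete.aemeasurable, lintegral_map Measurable.of_discrete (by fun_prop)]
    simp only [ENat.toENNReal_coe]
    rw [lintegral_natCast_poissonMeasure, ENNReal.coe_toNNReal hν]

lemma ae_hasSum_simpleFunc (hτ : IsPoissonPointProcess τ ν P) (F : SimpleFunc ℝ ℝ)
    (hF : Integrable F ν) :
    ∀ᵐ ω ∂P, HasSum (fun i => F (τ i ω))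
      (∑ c : F.range.erase 0, c.1 * (count τ (F ⁻¹' {c.1}) ω).toNat) := by
  have hsum : ∀ x, F x = ∑ c : F.range.erase 0, (F ⁻¹' {c.1}).indicator (fun _ => c.1) x := by
    intro x
    change F x = ∑ c : F.range.erase 0, if F x = c then c.1 else 0
    rw [Finset.sum_coe_sort (F.range.erase 0) fun c => if F x = c then c else 0,
      Finset.sum_ite_eq, ite_eq_left_iff.2]
    intro hx
    simpa [eq_comm] using hx
  have hfin : ∀ᵐ ω ∂P, ∀ c : F.range.erase 0, count τ (F ⁻¹' {c.1}) ω ≠ ⊤ :=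
    ae_all_iff.2 fun c => hτ.ae_count_ne_top (F.measurableSet_preimage _)
      (F.measure_preimage_lt_top_of_integrable hF (Finset.ne_of_mem_erase c.2)).ne
  filter_upwards [hfin] with ω hω
  rw [funext fun i => hsum (τ i ω)]
  exact hasSum_sum fun c _ => hasSum_indicator_count (hω c) _

variable [Countable ι]

lemma measurable_count (hτ : IsPoissonPointProcess τ ν P) {B : Set ℝ}
    (hB : MeasurableSet B) : Measurable (count τ B) :=
  measurable_encard.comp
    (measurable_set_iff.2 fun i => (measurable_mem.2 hB).comp (hτ.measurable i))

lemma measurable_tsum_comp (hτ : IsPoissonPointProcess τ ν P) {f : ℝ → ℝ}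
    (hf : Measurable f) : Measurable fun ω => ∑' i, f (τ i ω) :=
  Measurable.tsum fun i => hf.comp (hτ.measurable i)

lemma integral_cexp_tsum_simpleFunc (hτ : IsPoissonPointProcess τ ν P) (F : SimpleFunc ℝ ℝ)
    (hF : Integrable F ν) :
    ∫ ω, Complex.exp ((∑' i, F (τ i ω) : ℝ) * Complex.I) ∂P =
      Complex.exp (∫ x, (Complex.exp (F x * Complex.I) - 1) ∂ν) := by
  set φ : ℝ → ℂ := fun c => Complex.exp (c * Complex.I) - 1
  have hφ0 : φ 0 = 0 := by simp [φ]
  have hfin : ∀ c : F.range.erase 0, ν (F ⁻¹' {c.1}) ≠ ∞ := fun c =>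
    (F.measure_preimage_lt_top_of_integrable hF (Finset.ne_of_mem_erase c.2)).ne
  have hindep := hτ.iIndepFun_count (B := fun c : F.range.erase 0 => F ⁻¹' {c.1})
    (fun c => F.measurableSet_preimage _) fun c d hcd =>
      (disjoint_singleton.2 (Subtype.coe_injective.ne hcd)).preimage F
  have hintegral : ∫ x, φ (F x) ∂ν = ∑ c : F.range.erase 0, ν.real (F ⁻¹' {c.1}) * φ c := by
    have hφF : Integrable (F.map φ) ν :=
      SimpleFunc.integrable_iff_finMeasSupp.2 ((SimpleFunc.integrable_iff_finMeasSupp.1 hF).map hφ0)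
    refine (SimpleFunc.integral_eq_integral _ hφF).symm.trans ?_
    rw [SimpleFunc.map_integral F φ hF hφ0,
      Finset.sum_coe_sort (F.range.erase 0) fun c => (ν.real (F ⁻¹' {c}) : ℂ) * φ c]
    simp only [Complex.real_smul]
    refine (Finset.sum_erase _ ?_).symm
    rw [hφ0, mul_zero]
  calc ∫ ω, Complex.exp ((∑' i, F (τ i ω) : ℝ) * Complex.I) ∂P
      = ∫ ω, ∏ c : F.range.erase 0,
          Complex.exp (c.1 * (count τ (F ⁻¹' {c.1}) ω).toNat * Complex.I) ∂P := by
        refine integral_congr_ae ?_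
        filter_upwards [hτ.ae_hasSum_simpleFunc F hF] with ω hω
        rw [hω.tsum_eq, ← Complex.exp_sum]
        push_cast
        rw [Finset.sum_mul]
    _ = ∏ c : F.range.erase 0, Complex.exp (ν.real (F ⁻¹' {c.1}) * φ c) := by
        rw [hindep.integral_fun_prod_comp
          (f := fun (c : F.range.erase 0) n => Complex.exp (c.1 * n.toNat * Complex.I))
          (fun c => (hτ.measurable_count (F.measurableSet_preimage _)).aemeasurable)
          fun c => Measurable.of_discrete.aestronglyMeasurable]
        exact Finset.prod_congr rfl fun c _ =>
          hτ.integral_cexp_mul_count (F.measurableSet_preimage _) (hfin c) c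
    _ = Complex.exp (∫ x, φ (F x) ∂ν) := by rw [hintegral, Complex.exp_sum]

variable [IsProbabilityMeasure P]

lemma sum_map_eq (hτ : IsPoissonPointProcess τ ν P) :
    Measure.sum (fun i => P.map (τ i)) = ν := by
  ext B hB
  have hind : Measurable (B.indicator fun _ => (1 : ℝ≥0∞)) := measurable_const.indicator hB
  simp only [← hτ.lintegral_count hB, Measure.sum_apply _ hB, count_eq_tsum]
  rw [lintegral_tsum (f := fun i ω => B.indicator (fun _ => 1) (τ i ω))
    fun i => (hind.comp (hτ.measurable i)).aemeasurable]
  refine tsum_congr fun i => ?_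
  rw [← lintegral_map hind (hτ.measurable i), lintegral_indicator_const hB, one_mul]

lemma lintegral_tsum_comp (hτ : IsPoissonPointProcess τ ν P) {f : ℝ → ℝ≥0∞} (hf : Measurable f) :
    ∫⁻ ω, ∑' i, f (τ i ω) ∂P = ∫⁻ x, f x ∂ν := by
  rw [lintegral_tsum (f := fun i ω => f (τ i ω))
    fun i => (hf.comp (hτ.measurable i)).aemeasurable, ← hτ.sum_map_eq,
    lintegral_sum_measure]
  exact tsum_congr fun i => (lintegral_map hf (hτ.measurable i)).symm

lemma ae_summable (hτ : IsPoissonPointProcess τ ν P)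
    {f : ℝ → ℝ} (hf : Measurable f) (hi : Integrable f ν) :
    ∀ᵐ ω ∂P, Summable (fun i => f (τ i ω)) := by
  have hlt : ∀ᵐ ω ∂P, ∑' i, ‖f (τ i ω)‖ₑ < ∞ := by
    refine ae_lt_top' (AEMeasurable.tsum fun i =>
      (hf.enorm.comp (hτ.measurable i)).aemeasurable) ?_
    rw [hτ.lintegral_tsum_comp hf.enorm]
    exact hi.2.ne
  filter_upwards [hlt] with ω hω using Summable.of_enorm hω.ne

lemma tendsto_integral_cexp_tsum_approxOn (hτ : IsPoissonPointProcess τ ν P) {h : ℝ → ℝ}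
    (hh : Measurable h) (hhi : Integrable h ν) :
    Tendsto (fun n => ∫ ω, Complex.exp ((∑' i, SimpleFunc.approxOn h hh univ 0 (mem_univ _) n
      (τ i ω) : ℝ) * Complex.I) ∂P) atTop
      (𝓝 (∫ ω, Complex.exp ((∑' i, h (τ i ω) : ℝ) * Complex.I) ∂P)) := by
  have hcexp : Continuous fun y : ℝ => Complex.exp (y * Complex.I) := by fun_prop
  refine tendsto_integral_of_dominated_convergence (fun _ => (1 : ℝ)) (fun n => ?_)
    (integrable_const _) (fun n => ae_of_all _ fun ω => ?_) ?_
  · exact (hcexp.measurable.comp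
      (hτ.measurable_tsum_comp (SimpleFunc.measurable _))).aestronglyMeasurable
  · exact (Complex.norm_exp_ofReal_mul_I _).le
  · filter_upwards [hτ.ae_summable hh.norm hhi.norm] with ω hω
    refine (hcexp.tendsto _).comp (tendsto_tsum_of_dominated_convergence (hω.add hω)
      (fun i => SimpleFunc.tendsto_approxOn hh _ (by simp)) ?_)
    exact Eventually.of_forall fun n i => SimpleFunc.norm_approxOn_zero_le hh _ _ n

theorem integral_cexp_tsum (hτ : IsPoissonPointProcess τ ν P) {h : ℝ → ℝ}
    (hh : Measurable h) (hhi : Integrable h ν) :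
    ∫ ω, Complex.exp ((∑' i, h (τ i ω) : ℝ) * Complex.I) ∂P =
      Complex.exp (∫ x, (Complex.exp (h x * Complex.I) - 1) ∂ν) := by
  set F : ℕ → SimpleFunc ℝ ℝ := fun n => SimpleFunc.approxOn h hh univ 0 (mem_univ _) n
  have hFi : ∀ n, Integrable (F n) ν := fun n =>
    SimpleFunc.integrable_approxOn hh hhi _ (integrable_zero _ _ _) n
  have hcexp : Continuous fun y : ℝ => Complex.exp (y * Complex.I) - 1 := by fun_prop
  have hlim : Tendsto (fun n => ∫ x, (Complex.exp (F n x * Complex.I) - 1) ∂ν) atTop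
      (𝓝 (∫ x, (Complex.exp (h x * Complex.I) - 1) ∂ν)) := by
    refine tendsto_integral_of_dominated_convergence (fun x => ‖h x‖ + ‖h x‖) (fun n => ?_)
      (hhi.norm.add hhi.norm) (fun n => ae_of_all _ fun x => ?_) (ae_of_all _ fun x => ?_)
    · exact (hcexp.measurable.comp (F n).measurable).aestronglyMeasurable
    · rw [mul_comm]
      exact Real.norm_exp_I_mul_ofReal_sub_one_le.trans (SimpleFunc.norm_approxOn_zero_le hh _ x n)
    · exact (hcexp.tendsto _).comp (SimpleFunc.tendsto_approxOn hh _ (by simp))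
  refine tendsto_nhds_unique (hτ.tendsto_integral_cexp_tsum_approxOn hh hhi) ?_
  simp only [fun n => hτ.integral_cexp_tsum_simpleFunc (F n) (hFi n), F] at hlim ⊢
  exact (Complex.continuous_exp.tendsto _).comp hlim

lemma integral_cexp_tsum_mul_cexp_pow_count (hτ : IsPoissonPointProcess τ ν P) {f : ℝ → ℝ}
    (hf : Measurable f) (hfi : Integrable f ν) {W : Set ℝ} (hW : MeasurableSet W)
    (hν : ν W ≠ ∞) (θ : ℝ) :
    ∫ ω, Complex.exp ((∑' i, f (τ i ω) : ℝ) * Complex.I) *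
        Complex.exp (θ * Complex.I) ^ (count τ W ω).toNat ∂P =
      Complex.exp (∫ x in Wᶜ, (Complex.exp (f x * Complex.I) - 1) ∂ν - ν.real W) *
        Complex.exp (Complex.exp (θ * Complex.I) * ∫ x in W, Complex.exp (f x * Complex.I) ∂ν) := by
  have : IsFiniteMeasure (ν.restrict W) := isFiniteMeasure_restrict.2 hν
  -- A factor `exp (i θ)` per point of `W` is the characteristic functional at a shifted function.
  set h : ℝ → ℝ := fun x => f x + W.indicator (fun _ => θ) x
  have hh : Measurable h := hf.add (measurable_const.indicator hW)
  have hhi : Integrable h ν := hfi.add ((integrable_indicator_iff hW).2 (integrable_const θ))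
  calc ∫ ω, Complex.exp ((∑' i, f (τ i ω) : ℝ) * Complex.I) *
        Complex.exp (θ * Complex.I) ^ (count τ W ω).toNat ∂P
      = ∫ ω, Complex.exp ((∑' i, h (τ i ω) : ℝ) * Complex.I) ∂P := by
        refine integral_congr_ae ?_
        filter_upwards [hτ.ae_count_ne_top hW hν, hτ.ae_summable hf hfi] with ω hω hsum
        rw [(hsum.hasSum.add (hasSum_indicator_count hω θ)).tsum_eq, ← Complex.exp_nat_mul,
          ← Complex.exp_add]
        push_cast
        ring_nf
    _ = _ := by
        rw [hτ.integral_cexp_tsum hh hhi,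
          integral_cexp_add_indicator_sub_one hfi hW hν, add_comm, Complex.exp_add]

lemma setIntegral_cexp_tsum_count_eq (hτ : IsPoissonPointProcess τ ν P) {f : ℝ → ℝ}
    (hf : Measurable f) (hfi : Integrable f ν) {W : Set ℝ} (hW : MeasurableSet W)
    (hν : ν W ≠ ∞) (k : ℕ) :
    ∫ ω in {ω | count τ W ω = k}, Complex.exp ((∑' i, f (τ i ω) : ℝ) * Complex.I) ∂P =
      Complex.exp (∫ x in Wᶜ, (Complex.exp (f x * Complex.I) - 1) ∂ν - ν.real W) *
        ((∫ x in W, Complex.exp (f x * Complex.I) ∂ν) ^ k / k.factorial) := by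
  set e : Ω → ℂ := fun ω => Complex.exp ((∑' i, f (τ i ω) : ℝ) * Complex.I)
  set A := Complex.exp (∫ x in Wᶜ, (Complex.exp (f x * Complex.I) - 1) ∂ν - ν.real W)
  set J := ∫ x in W, Complex.exp (f x * Complex.I) ∂ν
  have he : Integrable e P := integrable_cexp_ofReal_mul_I (hτ.measurable_tsum_comp hf).aemeasurable
  have hseries (θ : ℝ) := hasSum_setIntegral_eq_natCast_mul_pow (hτ.measurable_count hW)
    (hτ.ae_count_ne_top hW hν) he (Complex.norm_exp_ofReal_mul_I θ).le
  have hexp (z : ℂ) : HasSum (fun n : ℕ => A * (J ^ n / n.factorial) * z ^ n)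
      (A * Complex.exp (z * J)) := by
    convert! (NormedSpace.expSeries_div_hasSum_exp (z * J)).mul_left A using 1
    · funext n
      rw [mul_pow]
      ring
    · rw [Complex.exp_eq_exp_ℂ]
  have hcoeff : (fun n : ℕ => ∫ ω in {ω | count τ W ω = n}, e ω ∂P) =
      fun n : ℕ => A * (J ^ n / n.factorial) := by
    refine eq_of_tsum_mul_cexp_pow_eq ?_ ?_ fun θ => ?_
    · simpa using (hseries 0).summable
    · simpa using (hexp 1).summable
    · rw [(hseries θ).tsum_eq, (hexp _).tsum_eq,
        hτ.integral_cexp_tsum_mul_cexp_pow_count hf hfi hW hν]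
  exact congrFun hcoeff k

lemma norm_setIntegral_cexp_tsum_count_eq_le (hτ : IsPoissonPointProcess τ ν P) {f : ℝ → ℝ}
    (hf : Measurable f) (hfi : Integrable f ν) {W : Set ℝ} (hW : MeasurableSet W)
    (hν : ν W ≠ ∞) (k : ℕ) :
    ‖∫ ω in {ω | count τ W ω = k}, Complex.exp ((∑' i, f (τ i ω) : ℝ) * Complex.I) ∂P‖ ≤
      Real.exp (-ν.real W) *
        (‖∫ x in W, Complex.exp (f x * Complex.I) ∂ν‖ ^ k / k.factorial) := by
  have hre : (∫ x in Wᶜ, (Complex.exp (f x * Complex.I) - 1) ∂ν).re ≤ 0 := by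
    rw [← RCLike.re_eq_complex_re,
      ← integral_re (integrable_cexp_ofReal_mul_I_sub_one hfi).integrableOn]
    refine integral_nonpos fun x => ?_
    simpa [Complex.exp_ofReal_mul_I_re] using Real.cos_le_one (f x)
  rw [hτ.setIntegral_cexp_tsum_count_eq hf hfi hW hν, norm_mul, norm_div, norm_pow,
    Complex.norm_natCast, Complex.norm_exp, Complex.sub_re, Complex.ofReal_re]
  gcongr
  linarith

theorem norm_setIntegral_cexp_tsum_le_count_le (hτ : IsPoissonPointProcess τ ν P) {f : ℝ → ℝ}
    (hf : Measurable f) (hfi : Integrable f ν) {W : Set ℝ} (hW : MeasurableSet W)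
    (hν : ν W ≠ ∞) (k₀ : ℕ) :
    ‖∫ ω in {ω | (k₀ : ℕ∞) ≤ count τ W ω},
        Complex.exp ((∑' i, f (τ i ω) : ℝ) * Complex.I) ∂P‖ ≤
      ‖∫ x in W, Complex.exp (f x * Complex.I) ∂ν‖ ^ k₀ := by
  set J := ‖∫ x in W, Complex.exp (f x * Complex.I) ∂ν‖
  have hJ : J ≤ ν.real W := by
    simpa using norm_setIntegral_le_of_norm_le_const hν.lt_top
      fun x _ => (Complex.norm_exp_ofReal_mul_I (f x)).le
  have hterm (j : ℕ) : ‖∫ ω in {ω | count τ W ω = (j + k₀ : ℕ)},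
      Complex.exp ((∑' i, f (τ i ω) : ℝ) * Complex.I) ∂P‖ ≤
      Real.exp (-ν.real W) * J ^ k₀ * (J ^ j / j.factorial) := by
    refine (hτ.norm_setIntegral_cexp_tsum_count_eq_le hf hfi hW hν (j + k₀)).trans ?_
    rw [mul_assoc, ← mul_div_assoc (J ^ k₀), ← pow_add, add_comm k₀ j]
    gcongr
    exact Nat.le_add_right j k₀
  rw [← (hasSum_setIntegral_eq_natCast (hτ.measurable_count hW) (hτ.ae_count_ne_top hW hν)
    (integrable_cexp_ofReal_mul_I (hτ.measurable_tsum_comp hf).aemeasurable) k₀).tsum_eq]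
  calc _ ≤ Real.exp (-ν.real W) * J ^ k₀ * Real.exp J := by
        refine tsum_of_norm_bounded (HasSum.mul_left _ ?_) hterm
        rw [Real.exp_eq_exp_ℝ]
        exact NormedSpace.expSeries_div_hasSum_exp J
    _ = Real.exp (J - ν.real W) * J ^ k₀ := by rw [sub_eq_add_neg, Real.exp_add]; ring
    _ ≤ J ^ k₀ := mul_le_of_le_one_left (by positivity) (Real.exp_le_one_iff.2 (by linarith))

end IsPoissonPointProcess

end PoissonPointProcess

section Density

lemma integrable_norm_pow_of_sqrt_mul_norm_le {φ : ℝ → ℂ} (hφ : AEStronglyMeasurable φ)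
    {A D : ℝ} (hA : ∀ u, ‖φ u‖ ≤ A) (hD : ∀ u, √|u| * ‖φ u‖ ≤ D) {k : ℕ} (hk : 3 ≤ k) :
    Integrable fun u => ‖φ u‖ ^ k := by
  have hbound : ∀ u, ‖φ u‖ ≤ (A + D) * (1 + ‖u‖) ^ (-(1 / 2) : ℝ) := fun u => by
    have hsqrt : √(1 + ‖u‖) ≤ 1 + √|u| := by
      rw [Real.sqrt_le_left (by positivity), add_sq, Real.sq_sqrt (abs_nonneg u), Real.norm_eq_abs]
      nlinarith [Real.sqrt_nonneg |u|]
    rw [Real.rpow_neg (by positivity), ← Real.sqrt_eq_rpow, ← div_eq_mul_inv,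
      le_div_iff₀ (by positivity), mul_comm]
    calc √(1 + ‖u‖) * ‖φ u‖ ≤ (1 + √|u|) * ‖φ u‖ := by gcongr
      _ = ‖φ u‖ + √|u| * ‖φ u‖ := by ring
      _ ≤ A + D := add_le_add (hA u) (hD u)
  have hdecay : Integrable fun u : ℝ => (A + D) ^ k * (1 + ‖u‖) ^ (-(k / 2) : ℝ) := by
    refine (integrable_one_add_norm ?_).const_mul _
    have : (3 : ℝ) ≤ k := by exact_mod_cast hk
    simp only [Module.finrank_self, Nat.cast_one]
    linarith
  refine hdecay.mono' (hφ.norm.pow k) (ae_of_all _ fun u => ?_)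
  rw [Real.norm_of_nonneg (by positivity)]
  refine (pow_le_pow_left₀ (norm_nonneg _) (hbound u) k).trans_eq ?_
  rw [mul_pow, ← Real.rpow_mul_natCast (by positivity)]
  ring_nf

namespace IsPoissonPointProcess

variable {ι Ω : Type*} {τ : ι → Ω → ℝ} [Countable ι] [MeasurableSpace Ω] {ν : Measure ℝ}
  {P : Measure Ω} [IsProbabilityMeasure P]

lemma norm_charFun_cond_le (hτ : IsPoissonPointProcess τ ν P) {f : ℝ → ℝ}
    (hf : Measurable f) (hfi : Integrable f ν) {W : Set ℝ} (hW : MeasurableSet W)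
    (hν : ν W ≠ ∞) (k₀ : ℕ) (u : ℝ) :
    ‖charFun (P[|{ω | (k₀ : ℕ∞) ≤ count τ W ω}].map fun ω => ∑' i, f (τ i ω)) u‖ ≤
      (P {ω | (k₀ : ℕ∞) ≤ count τ W ω})⁻¹.toReal *
        ‖∫ x in W, Complex.exp (u * f x * Complex.I) ∂ν‖ ^ k₀ := by
  have h := hτ.norm_setIntegral_cexp_tsum_le_count_le (hf.const_mul u) (hfi.const_mul u) hW hν k₀
  simp only [tsum_mul_left, Complex.ofReal_mul] at h
  rw [charFun_apply_real, integral_map (hτ.measurable_tsum_comp hf).aemeasurable (by fun_prop),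
    ProbabilityTheory.cond, integral_smul_measure, norm_smul,
    Real.norm_of_nonneg ENNReal.toReal_nonneg]
  exact mul_le_mul_of_nonneg_left h ENNReal.toReal_nonneg

theorem hasContinuousBoundedDensity_cond (hτ : IsPoissonPointProcess τ ν P) {f : ℝ → ℝ}
    (hf : Measurable f) (hfi : Integrable f ν) {W : Set ℝ} (hW : MeasurableSet W)
    (hν : ν W ≠ ∞) {D : ℝ}
    (hD : ∀ u : ℝ, √|u| * ‖∫ x in W, Complex.exp (u * f x * Complex.I) ∂ν‖ ≤ D)
    {k₀ : ℕ} (hk₀ : 3 ≤ k₀) {Y : Ω → ℝ} (hY : ∀ᵐ ω ∂P, Y ω = ∑' i, f (τ i ω)) :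
    HasContinuousBoundedDensity Y P[|{ω | (k₀ : ℕ∞) ≤ count τ W ω}] := by
  have hYX : Y =ᵐ[P[|{ω | (k₀ : ℕ∞) ≤ count τ W ω}]] fun ω => ∑' i, f (τ i ω) :=
    cond_absolutelyContinuous.ae_le hY
  have : IsFiniteMeasure (ν.restrict W) := isFiniteMeasure_restrict.2 hν
  have hJ : (fun u : ℝ => ∫ x in W, Complex.exp (u * f x * Complex.I) ∂ν) =
      charFun ((ν.restrict W).map f) := by
    funext u
    rw [charFun_apply_real, integral_map hf.aemeasurable (by fun_prop)]
  have hJW : ∀ u : ℝ, ‖∫ x in W, Complex.exp (u * f x * Complex.I) ∂ν‖ ≤ ν.real W := fun u => by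
    simpa using norm_setIntegral_le_of_norm_le_const hν.lt_top
      fun x _ => (norm_cexp_ofReal_mul_ofReal_mul_I u (f x)).le
  refine .of_integrable_charFun ((hτ.measurable_tsum_comp hf).aemeasurable.congr hYX.symm) ?_
  rw [Measure.map_congr hYX]
  refine .mono' ((integrable_norm_pow_of_sqrt_mul_norm_le ?_ hJW hD hk₀).const_mul _)
    continuous_charFun.aestronglyMeasurable
    (ae_of_all _ (hτ.norm_charFun_cond_le hf hfi hW hν k₀))
  rw [hJ]
  exact continuous_charFun.aestronglyMeasurable

end IsPoissonPointProcess

variable {T a b : ℝ} {g : ℝ → ℝ}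

lemma exists_sqrt_mul_norm_setIntegral_cexp_comp_sub_le (hT : 0 < T)
    (hg : ContDiffOn ℝ 2 g (Icc (-T + a) (T + b)))
    (hne : ∀ x ∈ Icc (-T + a) (T + b), iteratedDerivWithin 1 g (Icc (-T + a) (T + b)) x = 0 →
      iteratedDerivWithin 2 g (Icc (-T + a) (T + b)) x ≠ 0) (t : ℝ) {s : ℝ} (hs : s ∈ Icc a b) :
    ∃ D : ℝ, ∀ u : ℝ, √|u| * ‖∫ x in Icc (t - s - T) (t - s + T),
      Complex.exp (u * g (t - x) * Complex.I)‖ ≤ D := by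
  set J := Icc (-T + a) (T + b)
  have hU : UniqueDiffOn ℝ J := uniqueDiffOn_Icc (by linarith [hs.1, hs.2])
  have hsub : Icc (s - T) (s + T) ⊆ J :=
    Icc_subset_Icc (by linarith [hs.1]) (by linarith [hs.2])
  have hderiv {F : ℝ → ℝ} (hF : DifferentiableOn ℝ F J) {x : ℝ} (hx : x ∈ Ioo (s - T) (s + T)) :
      HasDerivAt F (derivWithin F J x) x :=
    (hF x (hsub (Ioo_subset_Icc_self hx))).hasDerivWithinAt.hasDerivAt
      (Filter.mem_of_superset (Icc_mem_nhds hx.1 hx.2) hsub)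
  have hcv (u : ℝ) : ∫ x in Icc (t - s - T) (t - s + T), Complex.exp (u * g (t - x) * Complex.I) =
      ∫ x in (s - T)..(s + T), Complex.exp (u * g x * Complex.I) := by
    rw [integral_Icc_eq_integral_Ioc, ← intervalIntegral.integral_of_le (by linarith),
      intervalIntegral.integral_comp_sub_left (fun x => Complex.exp (u * g x * Complex.I)) t]
    congr 1 <;> ring
  simp only [hcv]
  refine exists_sqrt_mul_norm_integral_cexp_le (h := iteratedDerivWithin 1 g J)
    (h₂ := iteratedDerivWithin 2 g J) (by linarith) (hg.continuousOn.mono hsub)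
    (fun x hx => ?_) ((hg.continuousOn_iteratedDerivWithin (by norm_num) hU).mono hsub)
    (fun x hx => ?_) ((hg.continuousOn_iteratedDerivWithin le_rfl hU).mono hsub)
    (fun x hx => hne x (hsub hx))
  · rw [iteratedDerivWithin_one]
    exact hderiv (hg.differentiableOn (by norm_num)) hx
  · have := hderiv (hg.differentiableOn_iteratedDerivWithin (m := 1) (by norm_num) hU) hx
    rwa [← iteratedDerivWithin_succ] at this

lemma IsPoissonPointProcess.hasContinuousBoundedDensity_cond_Icc {ι Ω : Type*} {τ : ι → Ω → ℝ}
    [Countable ι] [MeasurableSpace Ω] {P : Measure Ω} [IsProbabilityMeasure P] {lam : ℝ}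
    (hlam : 0 ≤ lam) (hτ : IsPoissonPointProcess τ (ENNReal.ofReal lam • volume) P) (hT : 0 < T)
    (hg : ContDiffOn ℝ 2 g (Icc (-T + a) (T + b)))
    (hne : ∀ x ∈ Icc (-T + a) (T + b), iteratedDerivWithin 1 g (Icc (-T + a) (T + b)) x = 0 →
      iteratedDerivWithin 2 g (Icc (-T + a) (T + b)) x ≠ 0)
    {t s : ℝ} (hs : s ∈ Icc a b) {f : ℝ → ℝ} (hf : Measurable f) (hfi : Integrable f)
    (hfg : EqOn f (fun x => g (t - x)) (Icc (t - s - T) (t - s + T))) {k₀ : ℕ} (hk₀ : 3 ≤ k₀)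
    {Y : Ω → ℝ} (hY : ∀ᵐ ω ∂P, Y ω = ∑' i, f (τ i ω)) :
    HasContinuousBoundedDensity Y
      P[|{ω | (k₀ : ℕ∞) ≤ count τ (Icc (t - s - T) (t - s + T)) ω}] := by
  obtain ⟨D, hD⟩ := exists_sqrt_mul_norm_setIntegral_cexp_comp_sub_le hT hg hne t hs
  refine hτ.hasContinuousBoundedDensity_cond (D := lam * D) hf
    (hfi.smul_measure ENNReal.ofReal_ne_top) measurableSet_Icc
    (ENNReal.mul_ne_top ENNReal.ofReal_ne_top measure_Icc_lt_top.ne) (fun u => ?_) hk₀ hY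
  rw [setIntegral_congr_fun measurableSet_Icc
      fun x hx => congrArg (fun y : ℝ => Complex.exp (u * y * Complex.I)) (hfg hx),
    Measure.restrict_smul, integral_smul_measure, ENNReal.toReal_ofReal hlam, norm_smul,
    Real.norm_of_nonneg hlam, mul_left_comm]
  exact mul_le_mul_of_nonneg_left (hD u) hlam

lemma ne_zero_of_isLeast_sqrt_sq_add_sq {α : Type*} {φ ψ : α → ℝ} {S : Set α} {m : ℝ}
    (hm : IsLeast ((fun x => √(φ x ^ 2 + ψ x ^ 2)) '' S) m) (hm_pos : 0 < m) {x : α} (hx : x ∈ S)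
    (hφ : φ x = 0) : ψ x ≠ 0 := fun hψ => by
  have hle : m ≤ √(φ x ^ 2 + ψ x ^ 2) := hm.2 (mem_image_of_mem _ hx)
  simp only [hφ, hψ, ne_eq, OfNat.ofNat_ne_zero, not_false_eq_true, zero_pow, add_zero,
    Real.sqrt_zero] at hle
  exact hm_pos.not_ge hle

end Density

lemma truncShotNoise_eq_tsum {ι Ω : Type*} (β : ι → Ω → ℝ) (g : ℝ → ℝ) (τ : ι → Ω → ℝ) (M t : ℝ)
    (ω : Ω) : truncShotNoise β g τ M t ω =
      ∑' i, β i ω * (Icc (-M) M).indicator (fun x => g (t - x)) (τ i ω) := by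
  refine (tsum_subtype {i | |τ i ω| ≤ M} fun i => β i ω * g (t - τ i ω)).trans
    (tsum_congr fun i => ?_)
  simp only [indicator_apply, mem_ofPred_eq, mem_Icc, abs_le, mul_ite, mul_zero]

end ShotNoise

open ShotNoise in
theorem proposition6_general {Ω ι : Type*} [MeasurableSpace Ω] [Countable ι]
    (P : Measure Ω) [IsProbabilityMeasure P]
    (lam : ℝ) (hlam : 0 < lam)
    (τ : ι → Ω → ℝ) (hτ : IsPoissonPointProcess τ (ENNReal.ofReal lam • volume) P)
    (β : ι → Ω → ℝ) (hβ : ∀ i, ∀ᵐ ω ∂P, β i ω = 1)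
    (T a b : ℝ) (hT : 0 < T)
    (g : ℝ → ℝ) (hg_meas : Measurable g) (hg_int : Integrable g volume)
    (hg : ContDiffOn ℝ 2 g (Icc (-T + a) (T + b)))
    (hne : ∀ x ∈ Icc (-T + a) (T + b), iteratedDerivWithin 1 g (Icc (-T + a) (T + b)) x = 0 →
      iteratedDerivWithin 2 g (Icc (-T + a) (T + b)) x ≠ 0)
    (k₀ : ℕ) (hk₀ : 3 ≤ k₀) :
    (∀ t : ℝ, ∀ᵐ ω ∂P, Summable (fun i => β i ω * g (t - τ i ω))) ∧
    (∀ t ∈ Icc a b, ∀ M, T ≤ M →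
      HasContinuousBoundedDensity (truncShotNoise β g τ M t)
        P[|{ω | (k₀ : ℕ∞) ≤ count τ (Icc (-T) T) ω}]) ∧
    (∀ t ∈ Icc a b,
      HasContinuousBoundedDensity (shotNoise β g τ t)
        P[|{ω | (k₀ : ℕ∞) ≤ count τ (Icc (-T) T) ω}]) ∧
    (∀ t : ℝ, ∀ s ∈ Icc a b,
      HasContinuousBoundedDensity (shotNoise β g τ t)
        P[|{ω | (k₀ : ℕ∞) ≤ count τ (Icc (t - s - T) (t - s + T)) ω}]) := by
  have hβ' : ∀ᵐ ω ∂P, ∀ i, β i ω = 1 := ae_all_iff.2 hβ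
  have hgm (t : ℝ) : Measurable fun x => g (t - x) := by fun_prop
  have hgi (t : ℝ) : Integrable fun x => g (t - x) := hg_int.comp_sub_left t
  have hfull : ∀ t : ℝ, ∀ s ∈ Icc a b, HasContinuousBoundedDensity (shotNoise β g τ t)
      P[|{ω | (k₀ : ℕ∞) ≤ count τ (Icc (t - s - T) (t - s + T)) ω}] := fun t s hs => by
    refine hτ.hasContinuousBoundedDensity_cond_Icc hlam.le hT hg hne hs (hgm t) (hgi t)
      (eqOn_refl _ _) hk₀ ?_
    filter_upwards [hβ'] with ω hω
    simp only [shotNoise, hω, one_mul]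
  refine ⟨fun t => ?_, fun t ht M hM => ?_, fun t ht => by simpa using hfull t t ht, hfull⟩
  · filter_upwards [hβ', hτ.ae_summable (hgm t) ((hgi t).smul_measure ENNReal.ofReal_ne_top)]
      with ω hω hsum
    simpa only [hω, one_mul] using hsum
  · have hsub : Icc (t - t - T) (t - t + T) ⊆ Icc (-M) M :=
      Icc_subset_Icc (by linarith) (by linarith)
    suffices HasContinuousBoundedDensity (truncShotNoise β g τ M t)
      P[|{ω | (k₀ : ℕ∞) ≤ count τ (Icc (t - t - T) (t - t + T)) ω}] by simpa using this
    refine hτ.hasContinuousBoundedDensity_cond_Icc hlam.le hT hg hne ht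
      ((hgm t).indicator measurableSet_Icc) ((hgi t).indicator measurableSet_Icc)
      (fun x hx => indicator_of_mem (hsub hx) _) hk₀ ?_
    filter_upwards [hβ'] with ω hω
    simp only [truncShotNoise_eq_tsum, hω, one_mul]

open ShotNoise in
theorem proposition6 {Ω ι : Type*} [MeasurableSpace Ω] [Countable ι]
    (P : Measure Ω) [IsProbabilityMeasure P]
    (lam : ℝ) (hlam : 0 < lam)
    (τ : ι → Ω → ℝ) (hτ : IsPoissonPointProcess τ (ENNReal.ofReal lam • volume) P)
    (β : ι → Ω → ℝ) (hβ : ∀ i, ∀ᵐ ω ∂P, β i ω = 1)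
    (T a b : ℝ) (hT : 0 < T) (hab : a < b)
    (g : ℝ → ℝ) (hg_meas : Measurable g) (hg_int : Integrable g volume)
    (hg : ContDiffOn ℝ 2 g (Icc (-T + a) (T + b)))
    (m : ℝ)
    (hm : IsLeast ((fun s => √(iteratedDerivWithin 1 g (Icc (-T + a) (T + b)) s ^ 2 +
      iteratedDerivWithin 2 g (Icc (-T + a) (T + b)) s ^ 2)) '' Icc (-T + a) (T + b)) m)
    (hm_pos : 0 < m)
    (hn₀ : {s ∈ Icc (-T + a) (T + b) |
      iteratedDerivWithin 2 g (Icc (-T + a) (T + b)) s = 0}.Finite)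
    (k₀ : ℕ) (hk₀ : 3 ≤ k₀) :
    -- the series defining the process converges absolutely a.s.
    (∀ t : ℝ, ∀ᵐ ω ∂P, Summable (fun i => β i ω * g (t - τ i ω))) ∧
    -- the truncated processes, given at least `k₀` points in `[-T, T]`
    (∀ t ∈ Icc a b, ∀ M, T ≤ M →
      HasContinuousBoundedDensity (truncShotNoise β g τ M t)
        P[|{ω | (k₀ : ℕ∞) ≤ count τ (Icc (-T) T) ω}]) ∧
    -- the full process, given at least `k₀` points in `[-T, T]`
    (∀ t ∈ Icc a b,
      HasContinuousBoundedDensity (shotNoise β g τ t)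
        P[|{ω | (k₀ : ℕ∞) ≤ count τ (Icc (-T) T) ω}]) ∧
    -- the full process at any time, given at least `k₀` points in the translated window
    (∀ t : ℝ, ∀ s ∈ Icc a b,
      HasContinuousBoundedDensity (shotNoise β g τ t)
        P[|{ω | (k₀ : ℕ∞) ≤ count τ (Icc (t - s - T) (t - s + T)) ω}]) :=
  proposition6_general P lam hlam τ hτ β hβ T a b hT g hg_meas hg_int hg
    (fun _ hx => ne_zero_of_isLeast_sqrt_sq_add_sq hm hm_pos hx) k₀ hk₀
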